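/- Let $p<0$, $q\in\mathbb R$, $b(x)=\tfrac14x^4+\tfrac12px^2+qx$, and $\Omega=\{(z_1,z_2)\in\mathbb C^2:\operatorname{Im}z_2>b(\operatorname{Re}z_1)\}$. For $f:\mathbb R\to\mathbb R$ let $f^*(\eta)=\sup_{\lambda\in\mathbb R}[\eta\lambda-f(\lambda)]$ denote the Legendre transform; $b^{**}=(b^*)^*$. For $\eta\in\mathbb R$, $\tau>0$ put $N(\eta,\tau)=\int_{-\infty}^{\infty}e^{2\tau[\eta\lambda-b(\lambda)]}\,d\lambda$, and let the Szegő kernel of $\Omega$ be given by $$S(z,w)=c\iint_{\tau>0}\tau\,e^{\eta\tau[z_1+\bar w_1]+i\tau[z_2-\bar w_2]}\,N(\eta,\tau)^{-1}\,d\eta\,d\tau,\qquad c=\frac1{4\pi^2}.$$ Write $z=(x+iy,\;t+ib(x)+ih)$ and $w=(r+is,\;u+ib(r)+ik)$ with $x,y,t,h,r,s,u,k\in\mathbb R$, and let $$\Sigma=\{(z,w):x=r,\ |x|>\sqrt{-p}\}\cup\{(z,w):|x|=|r|=\sqrt{-p}\}.$$ Let $D\subset\mathbb C^2\times\mathbb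 C^2$ be the region in which $$h+k+b(x)+b(r)-2b^{**}\!\left(\frac{x+r}2\right)>0 .$$ Then the integral defining $S(z,w)$ converges absolutely for all $(z,w)\in D$, and $D$ is an open neighbourhood of $(\overline\Omega\times\overline\Omega)\setminus\Sigma$. More generally, $S$ is infinitely differentiable on $D$, and for all non-negative integers $i_1,j_1,i_2,j_2$ and all $(z,w)\in D$, $$\partial_{z_1}^{i_1}\partial_{\bar w_1}^{j_1}\partial_{z_2}^{i_2}\partial_{\bar w_2}^{j_2}S(z,w)=c'\iint_{\tau>0}e^{\eta\tau[z_1+\bar w_1]+i\tau[z_2-\bar w_2]}\,\frac{\eta^{i_1+j_1}\,\tau^{i_1+j_1+i_2+j_2+1}}{N(\eta,\tau)}\,d\eta\,d\tau,\qquad c'=i^{\,i_2}(-i)^{j_2}c,$$ where the integral on the right converges absolutely. -/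

import Mathlib

open scoped ContDiff

namespace TubeSzego

noncomputable section

/-- The quartic `b(x) = x^4/4 + p x^2/2 + q x`. -/
def b (p q : ℝ) (x : ℝ) : ℝ := x ^ 4 / 4 + p * x ^ 2 / 2 + q * x

/-- The Legendre transform `f^*(η) = sup_{l ∈ ℝ} (η l - f l)`. Below it is used only for functions
for which the supremum is finite, see `bddAbove_legendre_b` and `bddAbove_legendre_legendre_b`. -/
def legendre (f : ℝ → ℝ) (η : ℝ) : ℝ := ⨆ l : ℝ, (η * l - f l)

/-- The supremum defining `b^*` is finite. -/
theorem bddAbove_legendre_b (p q η : ℝ) :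
    BddAbove (Set.range fun l : ℝ => η * l - b p q l) := by
  refine ⟨(η - q) ^ 2 / 2 + (1 - p) ^ 2 / 4, ?_⟩
  rintro _ ⟨l, rfl⟩
  simp only [b]
  nlinarith [sq_nonneg (η - q - l), sq_nonneg (l ^ 2 - (1 - p))]

/-- The supremum defining `b^{**}` is finite. -/
theorem bddAbove_legendre_legendre_b (p q x : ℝ) :
    BddAbove (Set.range fun η : ℝ => x * η - legendre (b p q) η) := by
  refine ⟨b p q x, ?_⟩
  rintro _ ⟨η, rfl⟩
  have h : η * x - b p q x ≤ legendre (b p q) η := le_ciSup (bddAbove_legendre_b p q η) x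
  simp only
  linarith

/-- The tube domain `Ω = {(z₁, z₂) : Im z₂ > b(Re z₁)}`. -/
def Ω (p q : ℝ) : Set (ℂ × ℂ) := {z | b p q z.1.re < z.2.im}

/-- The number `h` in `z = (x + i y, t + i b(x) + i h)`. -/
def height (p q : ℝ) (z : ℂ × ℂ) : ℝ := z.2.im - b p q z.1.re

/-- The set `Σ`, with `x = Re z₁` and `r = Re w₁`. -/
def singularSet (p : ℝ) : Set ((ℂ × ℂ) × (ℂ × ℂ)) :=
  {v | v.1.1.re = v.2.1.re ∧ √(-p) < |v.1.1.re|} ∪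
    {v | |v.1.1.re| = √(-p) ∧ |v.2.1.re| = √(-p)}

/-- The region `h + k + b(x) + b(r) - 2 b^{**}((x + r) / 2) > 0`. -/
def region (p q : ℝ) : Set ((ℂ × ℂ) × (ℂ × ℂ)) :=
  {v | 0 < height p q v.1 + height p q v.2 + b p q v.1.1.re + b p q v.2.1.re
      - 2 * legendre (legendre (b p q)) ((v.1.1.re + v.2.1.re) / 2)}

/-- `N(η, τ) = ∫ e^{2 τ (η l - b(l))} dl`. -/
def N (p q : ℝ) (η τ : ℝ) : ℝ := ∫ l : ℝ, Real.exp (2 * τ * (η * l - b p q l))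

/-- The exponential `e^{η τ (z₁ + conj w₁) + i τ (z₂ - conj w₂)}`. -/
def expFactor (v : (ℂ × ℂ) × (ℂ × ℂ)) (η τ : ℝ) : ℂ :=
  Complex.exp ((η : ℂ) * (τ : ℂ) * (v.1.1 + star v.2.1)
    + Complex.I * (τ : ℂ) * (v.1.2 - star v.2.2))

/-- The domain of integration `{(η, τ) : τ > 0}`. -/
def halfPlane : Set (ℝ × ℝ) := {s | 0 < s.2}

/-- The integrand of the Szegő kernel, as a function of `s = (η, τ)`. -/
def szegoIntegrand (p q : ℝ) (v : (ℂ × ℂ) × (ℂ × ℂ)) (s : ℝ × ℝ) : ℂ :=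
  (s.2 : ℂ) * expFactor v s.1 s.2 * ((N p q s.1 s.2 : ℝ) : ℂ)⁻¹

/-- The absolute constant in front of the integral; this is its value when the measure on the
boundary, identified with `ℝ³` through the coordinates `(x, y, t)`, is `dx dy dt`. -/
def szegoConst : ℂ := 1 / (4 * (Real.pi : ℂ) ^ 2)

/-- The Szegő kernel `S(z, w)`, `v = (z, w)`. -/
def szegoKernel (p q : ℝ) (v : (ℂ × ℂ) × (ℂ × ℂ)) : ℂ :=
  szegoConst * ∫ s in halfPlane, szegoIntegrand p q v s

/-- The integrand
`e^{η τ (z₁ + conj w₁) + i τ (z₂ - conj w₂)} η^{i₁+j₁} τ^{i₁+j₁+i₂+j₂+1} / N(η, τ)`. -/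
def derivIntegrand (p q : ℝ) (i₁ j₁ i₂ j₂ : ℕ) (v : (ℂ × ℂ) × (ℂ × ℂ)) (s : ℝ × ℝ) : ℂ :=
  expFactor v s.1 s.2 *
    (((s.1 ^ (i₁ + j₁) * s.2 ^ (i₁ + j₁ + i₂ + j₂ + 1) / N p q s.1 s.2 : ℝ)) : ℂ)

/-- The Wirtinger derivative `(∂_x - i ∂_y) / 2` in the complex direction `e`. -/
def wirtinger (e : (ℂ × ℂ) × (ℂ × ℂ)) (f : (ℂ × ℂ) × (ℂ × ℂ) → ℂ)
    (v : (ℂ × ℂ) × (ℂ × ℂ)) : ℂ :=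
  (1 / 2) * (fderiv ℝ f v e - Complex.I * fderiv ℝ f v (Complex.I • e))

/-- The conjugate Wirtinger derivative `(∂_x + i ∂_y) / 2` in the complex direction `e`. -/
def wirtingerBar (e : (ℂ × ℂ) × (ℂ × ℂ)) (f : (ℂ × ℂ) × (ℂ × ℂ) → ℂ)
    (v : (ℂ × ℂ) × (ℂ × ℂ)) : ℂ :=
  (1 / 2) * (fderiv ℝ f v e + Complex.I * fderiv ℝ f v (Complex.I • e))

/-- The operator `∂_{z₁}^{i₁} ∂_{conj w₁}^{j₁} ∂_{z₂}^{i₂} ∂_{conj w₂}^{j₂}`. -/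
def mixedDeriv (i₁ j₁ i₂ j₂ : ℕ) (f : (ℂ × ℂ) × (ℂ × ℂ) → ℂ) : (ℂ × ℂ) × (ℂ × ℂ) → ℂ :=
  (wirtinger ((1, 0), (0, 0)))^[i₁] ((wirtingerBar ((0, 0), (1, 0)))^[j₁]
    ((wirtinger ((0, 1), (0, 0)))^[i₂] ((wirtingerBar ((0, 0), (0, 1)))^[j₂] f)))

end

end TubeSzego

/-!
Write `m = (x + r) / 2` and `M = Im z₂ + Im w₂`, so that the region is `M > 2 b^{**}(m)`. The modulus
of the exponential in the integrand is `e^{τ (2 η m - M)}`, and `N(η, τ)` is roughly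
`e^{2 τ b^*(η)}`. Hence the integrand behaves like `e^{τ (2 η m - M - 2 b^*(η))}`, where
`2 (η m - b^*(η)) ≤ 2 b^{**}(m) < M` by the definition of the biconjugate. Since `b^*` grows faster
than any linear function, the exponent is even at most `-ε τ (1 + |η|)` (`exists_exponent_le`).
The lower bound for `N` does not need the precise Laplace asymptotics: it may lose any small
multiple of `τ (1 + |η|)` in the exponent (`exists_le_N`), and an interval of fixed length next to
an almost maximal point of `η l - b(l)` suffices for this, because `|l|³` is there at most of the
order of `1 + |η|`. Everything is uniform for `(z, w)` near a given point of the region, and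
`|η|^k τ^a e^{-ε τ (1 + |η|)}` is integrable over `τ > 0` when `a ≥ k + 1`
(`integrableOn_pow_mul_exp`).

The integrals with weights `η^k τ^a / N(η, τ)`, `a ≥ k + 1`, form a family that is closed under
differentiation in `(z, w)` (`hasFDerivAt_laplaceIntegral`); smoothness and the formula for the
mixed Wirtinger derivatives follow by induction.

The geometric part is the continuity of the convex function `b^{**}`, which gives openness of the
region, and the strict inequality `2 b^{**}(m) < b(x) + b(r)` away from the singular set
(`two_mul_legendre_legendre_b_lt`), which uses that `b^{**}` is at most `b` everywhere and at most
the double tangent line `q x - p² / 4` for `|x| ≤ √(-p)`.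
-/

namespace TubeSzego

open MeasureTheory Set Filter Topology

/-! ### The Legendre transform and the biconjugate -/

theorem le_legendre_b (p q η l : ℝ) : η * l - b p q l ≤ legendre (b p q) η :=
  le_ciSup (bddAbove_legendre_b p q η) l

theorem le_legendre_legendre_b (p q x η : ℝ) :
    x * η - legendre (b p q) η ≤ legendre (legendre (b p q)) x :=
  le_ciSup (bddAbove_legendre_legendre_b p q x) η

theorem legendre_legendre_b_le (p q x : ℝ) : legendre (legendre (b p q)) x ≤ b p q x := by
  refine ciSup_le fun η => ?_
  linarith [le_legendre_b p q η x]

/-- Between the two points `±√(-p)`, where the graph of `b` touches its double tangent line, the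
biconjugate lies below this line. -/
theorem legendre_legendre_b_le_of_sq_le {p q x : ℝ} (hp : p < 0) (hx : x ^ 2 ≤ -p) :
    legendre (legendre (b p q)) x ≤ q * x - p ^ 2 / 4 := by
  have hs : √(-p) ^ 2 = -p := Real.sq_sqrt (by linarith)
  have hs4 : √(-p) ^ 4 = p ^ 2 := by
    rw [show √(-p) ^ 4 = (√(-p) ^ 2) ^ 2 by ring, hs]; ring
  have hx' : |x| ≤ √(-p) := Real.abs_le_sqrt hx
  refine ciSup_le fun η => ?_
  have h1 := le_legendre_b p q η √(-p)
  have h2 := le_legendre_b p q η (-√(-p))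
  simp only [b, neg_sq, hs] at h1 h2
  rw [show (-√(-p)) ^ 4 = √(-p) ^ 4 by ring] at h2
  rw [hs4] at h1 h2
  have h3 := abs_le.1 hx'
  rcases le_total 0 (η - q) with h | h
  · nlinarith
  · nlinarith

theorem convexOn_legendre_legendre_b (p q : ℝ) :
    ConvexOn ℝ univ (legendre (legendre (b p q))) := by
  refine ⟨convex_univ, fun x _ y _ s t hs ht hst => ciSup_le fun η => ?_⟩
  have hx := mul_le_mul_of_nonneg_left (le_legendre_legendre_b p q x η) hs
  have hy := mul_le_mul_of_nonneg_left (le_legendre_legendre_b p q y η) ht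
  simp only [smul_eq_mul]
  have h : legendre (b p q) η = s * legendre (b p q) η + t * legendre (b p q) η := by
    rw [← add_mul, hst, one_mul]
  linarith

theorem continuous_legendre_legendre_b (p q : ℝ) :
    Continuous (legendre (legendre (b p q))) :=
  continuousOn_univ.1 ((convexOn_legendre_legendre_b p q).continuousOn isOpen_univ)

theorem continuous_b (p q : ℝ) : Continuous (b p q) := by
  unfold b
  fun_prop

/-! ### The region -/

theorem mem_region_iff {p q : ℝ} {v : (ℂ × ℂ) × (ℂ × ℂ)} :
    v ∈ region p q ↔ 2 * legendre (legendre (b p q)) ((v.1.1.re + v.2.1.re) / 2)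
      < v.1.2.im + v.2.2.im := by
  simp only [region, height, mem_ofPred_eq]
  constructor <;> intro h <;> linarith

theorem isOpen_region (p q : ℝ) : IsOpen (region p q) := by
  have h : region p q = {v | 2 * legendre (legendre (b p q)) ((v.1.1.re + v.2.1.re) / 2)
      < v.1.2.im + v.2.2.im} := by
    ext v
    exact mem_region_iff
  rw [h]
  have hc := continuous_legendre_legendre_b p q
  exact isOpen_lt (by fun_prop) (by fun_prop)

theorem b_le_im_of_mem_closure {p q : ℝ} {z : ℂ × ℂ} (hz : z ∈ closure (Ω p q)) :
    b p q z.1.re ≤ z.2.im := by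
  have hc := continuous_b p q
  have hcl : IsClosed {z : ℂ × ℂ | b p q z.1.re ≤ z.2.im} :=
    isClosed_le (by fun_prop) (by fun_prop)
  have hsub : Ω p q ⊆ {z : ℂ × ℂ | b p q z.1.re ≤ z.2.im} := fun w hw => by
    simp only [Ω, mem_ofPred_eq] at hw ⊢
    exact hw.le
  exact closure_minimal hsub hcl hz

/-- The inequality `2 b^{**}((x + r) / 2) < b(x) + b(r)` is strict away from the singular set: if
the midpoint lies between `±√(-p)`, then `b(x) + b(r)` exceeds twice the double tangent line by
`((x² + p)² + (r² + p)²) / 4`, and otherwise `b` is strictly convex around the midpoint. -/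
theorem two_mul_legendre_legendre_b_lt {p q x r : ℝ} (hp : p < 0)
    (h₁ : ¬(x = r ∧ √(-p) < |x|)) (h₂ : ¬(|x| = √(-p) ∧ |r| = √(-p))) :
    2 * legendre (legendre (b p q)) ((x + r) / 2) < b p q x + b p q r := by
  have hroot : ∀ y : ℝ, y ^ 2 + p = 0 → |y| = √(-p) := fun y hy => by
    rw [← Real.sqrt_sq_eq_abs]; congr 1; linarith
  rcases le_or_gt (((x + r) / 2) ^ 2) (-p) with hm | hm
  · have h := legendre_legendre_b_le_of_sq_le (q := q) hp hm
    have hpos : 0 < (x ^ 2 + p) ^ 2 + (r ^ 2 + p) ^ 2 := by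
      by_contra hcon
      refine h₂ ⟨hroot x ?_, hroot r ?_⟩ <;> refine pow_eq_zero_iff (two_ne_zero) |>.1 ?_ <;>
        nlinarith [sq_nonneg (x ^ 2 + p), sq_nonneg (r ^ 2 + p)]
    simp only [b]
    nlinarith
  · have hxr : x ≠ r := by
      rintro rfl
      refine h₁ ⟨rfl, ?_⟩
      rw [show (x + x) / 2 = x by ring] at hm
      exact (Real.sqrt_lt_sqrt (by linarith) hm).trans_eq (Real.sqrt_sq_eq_abs x)
    have h := legendre_legendre_b_le p q ((x + r) / 2)
    have hd : 0 < ((x - r) / 2) ^ 2 := by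
      have : (x - r) / 2 ≠ 0 := by intro h0; exact hxr (by linarith)
      positivity
    have key : b p q x + b p q r - 2 * b p q ((x + r) / 2) =
        ((x - r) / 2) ^ 2 * (3 * ((x + r) / 2) ^ 2 + p + ((x - r) / 2) ^ 2 / 2) := by
      simp only [b]; ring
    have : 0 < ((x - r) / 2) ^ 2 * (3 * ((x + r) / 2) ^ 2 + p + ((x - r) / 2) ^ 2 / 2) :=
      mul_pos hd (by linarith)
    linarith

theorem closure_prod_closure_diff_singularSet_subset_region {p : ℝ} (q : ℝ) (hp : p < 0) :
    (closure (Ω p q) ×ˢ closure (Ω p q)) \ singularSet p ⊆ region p q := by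
  rintro v ⟨⟨hz, hw⟩, hv⟩
  simp only [singularSet, mem_union, mem_ofPred_eq, not_or] at hv
  rw [mem_region_iff]
  have := two_mul_legendre_legendre_b_lt (q := q) hp hv.1 hv.2
  linarith [b_le_im_of_mem_closure hz, b_le_im_of_mem_closure hw]

/-! ### Bounds for the exponent and for the normalising factor -/

/-- The bound `-(M - 2 b^{**}(m))`, uniform in `η`, and the linear decay in `η` that comes from
testing `b^*` at `m ± 1` are combined convexly into a bound that has both features. -/
theorem exists_exponent_le {p q m M : ℝ} (hM : 2 * legendre (legendre (b p q)) m < M) :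
    ∃ ε > 0, ∀ η : ℝ, 2 * η * m - M - 2 * legendre (b p q) η ≤ -(ε * (1 + |η|)) := by
  set d := M - 2 * legendre (legendre (b p q)) m with hd
  have hd0 : 0 < d := by linarith
  set K := 2 * (|b p q (m + 1)| + |b p q (m - 1)|) + |M| with hK
  have hK0 : 0 ≤ K := by positivity
  set θ := d / (2 * (d + K)) with hθ
  have hθ0 : 0 < θ := by positivity
  have hθd : θ * (d + K) = d / 2 := by rw [hθ]; field_simp
  have hθ1 : θ ≤ 1 := by rw [hθ, div_le_one (by positivity)]; linarith
  refine ⟨min (d / 2) (2 * θ), by positivity, fun η => ?_⟩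
  have h1 : 2 * η * m - M - 2 * legendre (b p q) η ≤ -d := by
    linarith [le_legendre_legendre_b p q m η]
  have h2 : 2 * η * m - M - 2 * legendre (b p q) η ≤ -2 * |η| + K := by
    have ha := le_legendre_b p q η (m + 1)
    have hb := le_legendre_b p q η (m - 1)
    have hM' := neg_abs_le M
    have h3 := le_abs_self (b p q (m + 1))
    have h4 := le_abs_self (b p q (m - 1))
    have h5 := abs_nonneg (b p q (m + 1))
    have h6 := abs_nonneg (b p q (m - 1))
    rcases abs_cases η with ⟨h, _⟩ | ⟨h, _⟩ <;> rw [h] <;> nlinarith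
  have h3 := mul_le_mul_of_nonneg_left h2 hθ0.le
  have h4 := mul_le_mul_of_nonneg_left h1 (sub_nonneg.2 hθ1)
  have h5 := mul_le_mul_of_nonneg_right (min_le_right (d / 2) (2 * θ)) (abs_nonneg η)
  have h6 := min_le_left (d / 2) (2 * θ)
  linarith

/-- At a point where `η l - b(l)` is almost maximal, `|l|³` grows at most linearly in `η`. -/
theorem abs_cube_le_of_neg_one_le {p q η l : ℝ} (h : -1 ≤ η * l - b p q l) :
    |l| ^ 3 ≤ 8 * (1 + p ^ 2 + |q|) * (1 + |η|) := by
  simp only [b] at h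
  have hq := abs_nonneg q
  have hη := abs_nonneg η
  have hqη : 0 ≤ |q| * |η| := by positivity
  have hpη : 0 ≤ p ^ 2 * |η| := by positivity
  rcases le_total |l| 1 with hl | hl
  · have : |l| ^ 3 ≤ 1 := pow_le_one₀ (abs_nonneg l) hl
    nlinarith [sq_nonneg p]
  · have h1 : η * l ≤ |η| * |l| := by rw [← abs_mul]; exact le_abs_self _
    have h2 : -(q * l) ≤ |q| * |l| := by rw [← abs_mul]; exact neg_le_abs _
    have h3 : -(p * l ^ 2) ≤ |p| * |l| ^ 2 := by
      rw [sq_abs]; nlinarith [neg_le_abs p, sq_nonneg l]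
    have h4 : l ^ 4 = |l| ^ 4 := by rw [← abs_pow, abs_of_nonneg (by positivity)]
    rw [h4] at h
    have h5 : |l| ^ 3 / 4 ≤ 1 + |p| * |l| / 2 + |q| + |η| := by
      refine le_of_mul_le_mul_right ?_ (zero_lt_one.trans_le hl)
      nlinarith
    rcases le_total (4 * |p|) (|l| ^ 2) with h6 | h6
    · have : |p| * |l| / 2 ≤ |l| ^ 3 / 8 := by nlinarith
      nlinarith [sq_nonneg p]
    · have : |p| * |l| ≤ 4 * p ^ 2 := by
        rw [← sq_abs p]; nlinarith [abs_nonneg p]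
      nlinarith [sq_nonneg p]

theorem b_add_sub_le {p q l s : ℝ} (hs : 0 ≤ s) (hs1 : s ≤ 1) :
    b p q (l + s) - b p q l ≤ s * (6 * (1 + |p| + |q|) * (1 + |l| ^ 3)) := by
  have key : b p q (l + s) - b p q l =
      s * (l ^ 3 + 3 / 2 * l ^ 2 * s + l * s ^ 2 + s ^ 3 / 4 + p * l + p * s / 2 + q) := by
    simp only [b]; ring
  rw [key]
  refine mul_le_mul_of_nonneg_left ?_ hs
  have hl := abs_nonneg l
  have h3 : l ^ 3 ≤ |l| ^ 3 := by rw [← abs_pow]; exact le_abs_self _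
  have hl1 : |l| ≤ 1 + |l| ^ 3 := by
    rcases le_total |l| 1 with h | h
    · linarith [pow_nonneg hl 3]
    · nlinarith [mul_nonneg hl hl]
  have hl2 : |l| ^ 2 ≤ 1 + |l| ^ 3 := by
    rcases le_total |l| 1 with h | h
    · nlinarith [pow_nonneg hl 3]
    · nlinarith [mul_nonneg hl hl]
  have h2s : l ^ 2 * s ≤ |l| ^ 2 := by rw [sq_abs]; nlinarith [sq_nonneg l]
  have h1s : l * s ^ 2 ≤ |l| := by
    have : s ^ 2 ≤ 1 := pow_le_one₀ hs hs1
    nlinarith [le_abs_self l, sq_nonneg s]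
  have h0s : s ^ 3 ≤ 1 := pow_le_one₀ hs hs1
  have hpl : p * l ≤ |p| * |l| := by rw [← abs_mul]; exact le_abs_self _
  have hps : p * s ≤ |p| := by nlinarith [le_abs_self p, abs_nonneg p]
  have hpl' : |p| * |l| ≤ |p| * (1 + |l| ^ 3) := mul_le_mul_of_nonneg_left hl1 (abs_nonneg p)
  have hp3 : 0 ≤ |p| * |l| ^ 3 := by positivity
  have hq3 : 0 ≤ |q| * |l| ^ 3 := by positivity
  nlinarith [le_abs_self q, abs_nonneg p, abs_nonneg q, pow_nonneg hl 3]

theorem integrable_exp_two_mul_sub_b (p q η : ℝ) {τ : ℝ} (hτ : 0 < τ) :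
    Integrable fun l : ℝ => Real.exp (2 * τ * (η * l - b p q l)) := by
  have hc := continuous_b p q
  refine ((integrable_exp_neg_mul_sq hτ).const_mul
    (Real.exp (2 * τ * ((η - q) ^ 2 / 2 + (2 - p) ^ 2 / 4)))).mono'
    (by fun_prop) (Eventually.of_forall fun l => ?_)
  rw [Real.norm_eq_abs, Real.abs_exp, ← Real.exp_add]
  refine Real.exp_le_exp.2 ?_
  have h : η * l - b p q l ≤ (η - q) ^ 2 / 2 + (2 - p) ^ 2 / 4 - l ^ 2 / 2 := by
    simp only [b]
    nlinarith [sq_nonneg (η - q - l), sq_nonneg (l ^ 2 - (2 - p))]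
  have := mul_le_mul_of_nonneg_left h (by positivity : 0 ≤ 2 * τ)
  linarith

/-- A lower bound for `N(η, τ)` that loses only an arbitrarily small part of the exponent: on an
interval of fixed length next to an almost maximal point of `η l - b(l)`, this function differs
from `b^*(η)` by at most a small multiple of `1 + |η|`. -/
theorem exists_le_N (p q : ℝ) {ε : ℝ} (hε : 0 < ε) :
    ∃ c > 0, ∀ η τ : ℝ, 0 < τ →
      c * Real.exp (τ * (2 * legendre (b p q) η - ε * (1 + |η|))) ≤ N p q η τ := by
  set K := 1 + 6 * (1 + |p| + |q|) * (1 + 8 * (1 + p ^ 2 + |q|)) with hK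
  have hK0 : 0 < K := by positivity
  set δ := min 1 (ε / (4 * K)) with hδ
  have hδ0 : 0 < δ := by positivity
  have hδK : δ * K ≤ ε / 4 := by
    calc δ * K ≤ ε / (4 * K) * K := by gcongr; exact min_le_right _ _
      _ = ε / 4 := by field_simp
  refine ⟨δ, hδ0, fun η τ hτ => ?_⟩
  obtain ⟨l, hl⟩ : ∃ l : ℝ, legendre (b p q) η - min 1 (ε / 4) < η * l - b p q l :=
    exists_lt_of_lt_ciSup (sub_lt_self _ (by positivity))
  have h0 : 0 ≤ legendre (b p q) η := by
    have := le_legendre_b p q η 0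
    simpa [b] using this
  have hcube := abs_cube_le_of_neg_one_le (p := p) (q := q) (η := η) (l := l)
    (by linarith [min_le_left 1 (ε / 4)])
  have hvar : ∀ x ∈ Icc l (l + δ),
      τ * (2 * legendre (b p q) η - ε * (1 + |η|)) ≤ 2 * τ * (η * x - b p q x) := by
    intro x hx
    obtain ⟨s, rfl⟩ : ∃ s, x = l + s := ⟨x - l, by ring⟩
    have hs0 : 0 ≤ s := by linarith [hx.1]
    have hsδ : s ≤ δ := by linarith [hx.2]
    have hb := b_add_sub_le (p := p) (q := q) (l := l) hs0 (hsδ.trans (min_le_left _ _))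
    have h1 : |η| + 6 * (1 + |p| + |q|) * (1 + |l| ^ 3) ≤ K * (1 + |η|) := by
      have h2 : 6 * (1 + |p| + |q|) * (1 + |l| ^ 3) ≤
          6 * (1 + |p| + |q|) * ((1 + 8 * (1 + p ^ 2 + |q|)) * (1 + |η|)) := by
        gcongr
        nlinarith [abs_nonneg η]
      rw [hK]
      linarith
    have h3 : s * (|η| + 6 * (1 + |p| + |q|) * (1 + |l| ^ 3)) ≤ ε / 4 * (1 + |η|) := by
      calc s * (|η| + 6 * (1 + |p| + |q|) * (1 + |l| ^ 3)) ≤ δ * (K * (1 + |η|)) := by gcongr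
        _ = δ * K * (1 + |η|) := by ring
        _ ≤ ε / 4 * (1 + |η|) := by gcongr
    have h4 : -(η * s) ≤ s * |η| := by nlinarith [neg_abs_le η]
    have h5 : legendre (b p q) η - ε / 2 * (1 + |η|) ≤ η * (l + s) - b p q (l + s) := by
      have := min_le_right 1 (ε / 4)
      nlinarith [abs_nonneg η]
    have := mul_le_mul_of_nonneg_left h5 (by positivity : 0 ≤ 2 * τ)
    linarith
  have hint := integrable_exp_two_mul_sub_b p q η hτ
  calc δ * Real.exp (τ * (2 * legendre (b p q) η - ε * (1 + |η|)))
      = ∫ _ in Icc l (l + δ), Real.exp (τ * (2 * legendre (b p q) η - ε * (1 + |η|))) := by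
        simp [hδ0.le]
    _ ≤ ∫ x in Icc l (l + δ), Real.exp (2 * τ * (η * x - b p q x)) :=
        setIntegral_mono_on (by simp) hint.integrableOn measurableSet_Icc
          fun x hx => Real.exp_le_exp.2 (hvar x hx)
    _ ≤ N p q η τ :=
        setIntegral_le_integral hint (Eventually.of_forall fun x => (Real.exp_pos _).le)

theorem measurable_N (p q : ℝ) : Measurable fun s : ℝ × ℝ => N p q s.1 s.2 := by
  have hc := continuous_b p q
  have h : StronglyMeasurable fun x : (ℝ × ℝ) × ℝ =>
      Real.exp (2 * x.1.2 * (x.1.1 * x.2 - b p q x.2)) :=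
    Continuous.stronglyMeasurable (by fun_prop)
  exact h.integral_prod_right'.measurable

/-! ### Integrable majorants on the half plane -/

theorem volume_restrict_halfPlane :
    (volume : Measure (ℝ × ℝ)).restrict halfPlane =
      (volume : Measure ℝ).prod ((volume : Measure ℝ).restrict (Ioi 0)) := by
  have h : halfPlane = univ ×ˢ Ioi (0 : ℝ) := by
    ext s; simp [halfPlane]
  rw [h, Measure.volume_eq_prod, ← Measure.prod_restrict, Measure.restrict_univ]

theorem measurableSet_halfPlane : MeasurableSet halfPlane :=
  measurableSet_lt measurable_const measurable_snd

theorem integral_exp_neg_mul_abs {c : ℝ} (hc : 0 < c) :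
    ∫ x : ℝ, Real.exp (-(c * |x|)) = 2 / c := by
  rw [integral_comp_abs (f := fun x => Real.exp (-(c * x)))]
  have h := integral_exp_mul_Ioi (neg_lt_zero.2 hc) 0
  simp only [neg_mul, mul_zero, Real.exp_zero] at h
  rw [h]
  field_simp

theorem integrable_exp_neg_mul_abs {c : ℝ} (hc : 0 < c) :
    Integrable fun x : ℝ => Real.exp (-(c * |x|)) := by
  -- A function with nonzero Bochner integral is integrable.
  refine Integrable.of_integral_ne_zero ?_
  rw [integral_exp_neg_mul_abs hc]
  positivity

/-- Integrating first in `η` leaves `(2 / ε) e^{-ε τ}`: the factor `τ` absorbs the blow-up `2 / (ε τ)`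
of the integral of `e^{-ε τ |η|}` as `τ → 0`. -/
theorem integrableOn_snd_mul_exp {ε : ℝ} (hε : 0 < ε) :
    IntegrableOn (fun s : ℝ × ℝ => s.2 * Real.exp (-(ε * (s.2 * (1 + |s.1|))))) halfPlane := by
  have hsplit : ∀ η τ : ℝ, τ * Real.exp (-(ε * (τ * (1 + |η|)))) =
      τ * Real.exp (-(ε * τ)) * Real.exp (-(ε * τ * |η|)) := fun η τ => by
    rw [mul_assoc, ← Real.exp_add]; ring_nf
  rw [IntegrableOn, volume_restrict_halfPlane,
    integrable_prod_iff' (Continuous.aestronglyMeasurable (by fun_prop))]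
  constructor
  · refine (ae_restrict_iff' measurableSet_Ioi).2 (Eventually.of_forall fun τ hτ => ?_)
    simp only [hsplit]
    exact (integrable_exp_neg_mul_abs (mul_pos hε hτ)).const_mul _
  · have h : IntegrableOn (fun τ : ℝ => 2 / ε * Real.exp (-ε * τ)) (Ioi 0) :=
      (integrableOn_exp_mul_Ioi (neg_lt_zero.2 hε) 0).const_mul _
    refine h.congr_fun (fun τ hτ => ?_) measurableSet_Ioi
    have hτ' : 0 < τ := hτ
    simp only [hsplit, norm_mul, Real.norm_eq_abs, Real.abs_exp, abs_of_pos hτ']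
    rw [integral_const_mul, integral_exp_neg_mul_abs (mul_pos hε hτ')]
    field_simp

/-- The power of `τ` has to exceed that of `η` by at least one, since integration in `η` over
`e^{-ε τ |η|} |η|^k` produces the factor `τ^{-k-1}`. -/
theorem integrableOn_pow_mul_exp {ε : ℝ} (hε : 0 < ε) {k a : ℕ} (hka : k + 1 ≤ a) :
    IntegrableOn (fun s : ℝ × ℝ =>
      |s.1| ^ k * s.2 ^ a * Real.exp (-(ε * (s.2 * (1 + |s.1|))))) halfPlane := by
  obtain ⟨n, rfl⟩ := Nat.exists_eq_add_of_le hka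
  refine Integrable.mono' ((integrableOn_snd_mul_exp (half_pos hε)).const_mul
    (((k + n).factorial : ℝ) / (ε / 2) ^ (k + n)))
    (Continuous.aestronglyMeasurable (by fun_prop)) ?_
  refine (ae_restrict_iff' measurableSet_halfPlane).2 (Eventually.of_forall fun s hs => ?_)
  obtain ⟨η, τ⟩ := s
  have hτ : 0 < τ := hs
  simp only
  set T := τ * (1 + |η|) with hT
  have hT0 : 0 ≤ T := by positivity
  have h1 : |η| ^ k * τ ^ (k + n) ≤ T ^ (k + n) := by
    calc |η| ^ k * τ ^ (k + n) = (τ * |η|) ^ k * τ ^ n := by ring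
      _ ≤ T ^ k * T ^ n := by
        gcongr
        · rw [hT]; gcongr; linarith
        · rw [hT]; nlinarith [mul_nonneg hτ.le (abs_nonneg η)]
      _ = T ^ (k + n) := by ring
  have h2 : T ^ (k + n) ≤ (k + n).factorial / (ε / 2) ^ (k + n) * Real.exp (ε / 2 * T) := by
    have h := Real.pow_div_factorial_le_exp (ε / 2 * T) (by positivity) (k + n)
    rw [div_le_iff₀ (by positivity), mul_pow] at h
    rw [div_mul_eq_mul_div, le_div_iff₀ (by positivity)]
    linarith
  have h3 : Real.exp (-(ε * T)) = Real.exp (-(ε / 2 * T)) * Real.exp (-(ε / 2 * T)) := by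
    rw [← Real.exp_add]; ring_nf
  have h4 : Real.exp (ε / 2 * T) * Real.exp (-(ε / 2 * T)) = 1 := by
    rw [← Real.exp_add]; simp
  rw [Real.norm_of_nonneg (by positivity)]
  calc |η| ^ k * τ ^ (k + 1 + n) * Real.exp (-(ε * T))
      = τ * Real.exp (-(ε / 2 * T)) * ((|η| ^ k * τ ^ (k + n)) * Real.exp (-(ε / 2 * T))) := by
        rw [h3]; ring
    _ ≤ τ * Real.exp (-(ε / 2 * T)) * (((k + n).factorial / (ε / 2) ^ (k + n) *
          Real.exp (ε / 2 * T)) * Real.exp (-(ε / 2 * T))) := by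
        have := h1.trans h2
        gcongr
    _ = (k + n).factorial / (ε / 2) ^ (k + n) * (τ * Real.exp (-(ε / 2 * T))) := by
        rw [mul_assoc (_ / _ : ℝ), h4]; ring

/-! ### The family of Laplace type integrals -/

/-- The integrand `e^{η τ (z₁ + conj w₁) + i τ (z₂ - conj w₂)} η^k τ^a / N(η, τ)`, with free
exponents `k` and `a`; the family of these is stable under differentiation in `v = (z, w)`. -/
noncomputable def laplaceIntegrand (p q : ℝ) (k a : ℕ) (v : (ℂ × ℂ) × (ℂ × ℂ)) (s : ℝ × ℝ) : ℂ :=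
  expFactor v s.1 s.2 * ((s.1 ^ k * s.2 ^ a / N p q s.1 s.2 : ℝ) : ℂ)

/-- The integral of `laplaceIntegrand` over the half plane `τ > 0`. -/
noncomputable def laplaceIntegral (p q : ℝ) (k a : ℕ) (v : (ℂ × ℂ) × (ℂ × ℂ)) : ℂ :=
  ∫ s in halfPlane, laplaceIntegrand p q k a v s

theorem norm_expFactor (v : (ℂ × ℂ) × (ℂ × ℂ)) (η τ : ℝ) :
    ‖expFactor v η τ‖ =
      Real.exp (τ * (η * (v.1.1.re + v.2.1.re) - (v.1.2.im + v.2.2.im))) := by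
  rw [expFactor, Complex.norm_exp]
  congr 1
  simp
  ring

theorem measurable_laplaceIntegrand (p q : ℝ) (k a : ℕ) (v : (ℂ × ℂ) × (ℂ × ℂ)) :
    Measurable (laplaceIntegrand p q k a v) := by
  have h1 : Measurable fun s : ℝ × ℝ => expFactor v s.1 s.2 := by
    unfold expFactor
    exact Continuous.measurable (by fun_prop)
  have h2 := measurable_N p q
  unfold laplaceIntegrand
  exact h1.mul (Complex.measurable_ofReal.comp (by fun_prop))

/-- Locally uniformly on the region, the exponential divided by `N(η, τ)` is `O(e^{-ε τ (1 + |η|)})`.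
Of the gap `ε (1 + |η|)` in the exponent, a quarter pays for the lower bound of `N` and a quarter
for moving the base point. -/
theorem exists_norm_expFactor_div_N_le {p q : ℝ} {v : (ℂ × ℂ) × (ℂ × ℂ)} (hv : v ∈ region p q) :
    ∃ ε > 0, ∃ C : ℝ, ∀ᶠ v' in 𝓝 v, ∀ η τ : ℝ, 0 < τ →
      ‖expFactor v' η τ‖ / N p q η τ ≤ C * Real.exp (-(ε * (τ * (1 + |η|)))) ∧ 0 < N p q η τ := by
  obtain ⟨ε, hε, hexp⟩ := exists_exponent_le (mem_region_iff.1 hv)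
  obtain ⟨c, hc, hN⟩ := exists_le_N p q (ε := ε / 4) (by positivity)
  refine ⟨ε / 2, by positivity, c⁻¹, ?_⟩
  have hx : Continuous fun v' : (ℂ × ℂ) × (ℂ × ℂ) => v'.1.1.re + v'.2.1.re := by fun_prop
  have hy : Continuous fun v' : (ℂ × ℂ) × (ℂ × ℂ) => v'.1.2.im + v'.2.2.im := by fun_prop
  filter_upwards [Metric.tendsto_nhds.1 (hx.tendsto v) (ε / 8) (by positivity),
    Metric.tendsto_nhds.1 (hy.tendsto v) (ε / 8) (by positivity)] with v' hx' hy' η τ hτ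
  rw [Real.dist_eq] at hx' hy'
  have hNη := hN η τ hτ
  have hpos : 0 < c * Real.exp (τ * (2 * legendre (b p q) η - ε / 4 * (1 + |η|))) := by
    positivity
  refine ⟨?_, hpos.trans_le hNη⟩
  rw [div_le_iff₀ (hpos.trans_le hNη), norm_expFactor]
  have h1 : η * (v'.1.1.re + v'.2.1.re) - (v'.1.2.im + v'.2.2.im) ≤
      2 * legendre (b p q) η - ε * (1 + |η|) + ε / 4 * (1 + |η|) := by
    have h2 := hexp η
    have h3 : η * ((v'.1.1.re + v'.2.1.re) - (v.1.1.re + v.2.1.re)) ≤ |η| * (ε / 8) :=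
      (le_abs_self _).trans (by rw [abs_mul]; gcongr)
    have h4 := (abs_lt.1 hy').1
    have h5 : 0 ≤ ε * |η| := by positivity
    linarith
  calc Real.exp (τ * (η * (v'.1.1.re + v'.2.1.re) - (v'.1.2.im + v'.2.2.im)))
      ≤ Real.exp (-(ε / 2 * (τ * (1 + |η|))) +
          τ * (2 * legendre (b p q) η - ε / 4 * (1 + |η|))) := by
        refine Real.exp_le_exp.2 ((mul_le_mul_of_nonneg_left h1 hτ.le).trans_eq ?_)
        ring
    _ = c⁻¹ * Real.exp (-(ε / 2 * (τ * (1 + |η|)))) *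
          (c * Real.exp (τ * (2 * legendre (b p q) η - ε / 4 * (1 + |η|)))) := by
        rw [Real.exp_add]; field_simp
    _ ≤ c⁻¹ * Real.exp (-(ε / 2 * (τ * (1 + |η|)))) * N p q η τ := by gcongr

theorem exists_integrableOn_bound {p q : ℝ} {v : (ℂ × ℂ) × (ℂ × ℂ)} (hv : v ∈ region p q)
    {k a : ℕ} (hka : k + 1 ≤ a) :
    ∃ g : ℝ × ℝ → ℝ, IntegrableOn g halfPlane ∧
      ∀ᶠ v' in 𝓝 v, ∀ s ∈ halfPlane, ‖laplaceIntegrand p q k a v' s‖ ≤ g s := by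
  obtain ⟨ε, hε, C, hC⟩ := exists_norm_expFactor_div_N_le hv
  refine ⟨_, (integrableOn_pow_mul_exp hε hka).const_mul C, ?_⟩
  filter_upwards [hC] with v' hv' s hs
  obtain ⟨h, hN⟩ := hv' s.1 s.2 hs
  have hτ : 0 < s.2 := hs
  rw [laplaceIntegrand, norm_mul, Complex.norm_real, norm_div, norm_mul, norm_pow, norm_pow,
    Real.norm_of_nonneg hN.le, Real.norm_of_nonneg hτ.le, Real.norm_eq_abs]
  calc ‖expFactor v' s.1 s.2‖ * (|s.1| ^ k * s.2 ^ a / N p q s.1 s.2)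
      = |s.1| ^ k * s.2 ^ a * (‖expFactor v' s.1 s.2‖ / N p q s.1 s.2) := by ring
    _ ≤ |s.1| ^ k * s.2 ^ a * (C * Real.exp (-(ε * (s.2 * (1 + |s.1|))))) := by gcongr
    _ = C * (|s.1| ^ k * s.2 ^ a * Real.exp (-(ε * (s.2 * (1 + |s.1|))))) := by ring

theorem integrableOn_laplaceIntegrand {p q : ℝ} {v : (ℂ × ℂ) × (ℂ × ℂ)} (hv : v ∈ region p q)
    {k a : ℕ} (hka : k + 1 ≤ a) : IntegrableOn (laplaceIntegrand p q k a v) halfPlane := by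
  obtain ⟨g, hg, hb⟩ := exists_integrableOn_bound hv hka
  exact Integrable.mono' hg (measurable_laplaceIntegrand p q k a v).aestronglyMeasurable
    ((ae_restrict_iff' measurableSet_halfPlane).2 (Eventually.of_forall hb.self_of_nhds))

/-! ### Differentiation under the integral sign -/

/-- The real linear form `(z, w) ↦ z₁ + conj w₁`. -/
noncomputable def formOne : (ℂ × ℂ) × (ℂ × ℂ) →L[ℝ] ℂ :=
  ContinuousLinearMap.fst ℝ ℂ ℂ ∘L ContinuousLinearMap.fst ℝ (ℂ × ℂ) (ℂ × ℂ) +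
    (Complex.conjCLE : ℂ →L[ℝ] ℂ) ∘L
      (ContinuousLinearMap.fst ℝ ℂ ℂ ∘L ContinuousLinearMap.snd ℝ (ℂ × ℂ) (ℂ × ℂ))

/-- The real linear form `(z, w) ↦ z₂ - conj w₂`. -/
noncomputable def formTwo : (ℂ × ℂ) × (ℂ × ℂ) →L[ℝ] ℂ :=
  ContinuousLinearMap.snd ℝ ℂ ℂ ∘L ContinuousLinearMap.fst ℝ (ℂ × ℂ) (ℂ × ℂ) -
    (Complex.conjCLE : ℂ →L[ℝ] ℂ) ∘L
      (ContinuousLinearMap.snd ℝ ℂ ℂ ∘L ContinuousLinearMap.snd ℝ (ℂ × ℂ) (ℂ × ℂ))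

theorem formOne_apply (v : (ℂ × ℂ) × (ℂ × ℂ)) : formOne v = v.1.1 + star v.2.1 := by
  simp [formOne]

theorem formTwo_apply (v : (ℂ × ℂ) × (ℂ × ℂ)) : formTwo v = v.1.2 - star v.2.2 := by
  simp [formTwo]

theorem hasFDerivAt_laplaceIntegrand (p q : ℝ) (k a : ℕ) (v : (ℂ × ℂ) × (ℂ × ℂ)) (s : ℝ × ℝ) :
    HasFDerivAt (fun v => laplaceIntegrand p q k a v s)
      (laplaceIntegrand p q (k + 1) (a + 1) v s • formOne +
        (Complex.I * laplaceIntegrand p q k (a + 1) v s) • formTwo) v := by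
  have h1 : HasFDerivAt (fun v => ((s.1 : ℂ) * (s.2 : ℂ)) * formOne v +
      (Complex.I * (s.2 : ℂ)) * formTwo v)
      (((s.1 : ℂ) * (s.2 : ℂ)) • formOne + (Complex.I * (s.2 : ℂ)) • formTwo) v :=
    (formOne.hasFDerivAt.const_mul _).add (formTwo.hasFDerivAt.const_mul _)
  have h2 := h1.cexp.mul_const ((s.1 ^ k * s.2 ^ a / N p q s.1 s.2 : ℝ) : ℂ)
  simp only [formOne_apply, formTwo_apply] at h2
  refine h2.congr_fderiv ?_
  refine ContinuousLinearMap.ext fun e => ?_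
  simp [laplaceIntegrand, expFactor]
  ring

/-- Differentiation along `z₁ + conj w₁` raises both exponents, which keeps `k + 1 ≤ a`, and
differentiation along `z₂ - conj w₂` raises only the exponent of `τ`. -/
theorem hasFDerivAt_laplaceIntegral {p q : ℝ} {v : (ℂ × ℂ) × (ℂ × ℂ)} (hv : v ∈ region p q)
    {k a : ℕ} (hka : k + 1 ≤ a) :
    HasFDerivAt (laplaceIntegral p q k a)
      (laplaceIntegral p q (k + 1) (a + 1) v • formOne +
        (Complex.I * laplaceIntegral p q k (a + 1) v) • formTwo) v := by
  obtain ⟨g₁, hg₁, hb₁⟩ := exists_integrableOn_bound hv (k := k + 1) (a := a + 1) (by omega)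
  obtain ⟨g₂, hg₂, hb₂⟩ := exists_integrableOn_bound hv (k := k) (a := a + 1) (by omega)
  have hi₁ := integrableOn_laplaceIntegrand hv (k := k + 1) (a := a + 1) (by omega)
  have hi₂ := integrableOn_laplaceIntegrand hv (k := k) (a := a + 1) (by omega)
  have hmain := hasFDerivAt_integral_of_dominated_of_fderiv_le (𝕜 := ℝ)
    (μ := volume.restrict halfPlane) (F := laplaceIntegrand p q k a)
    (F' := fun v s => laplaceIntegrand p q (k + 1) (a + 1) v s • formOne +
        (Complex.I * laplaceIntegrand p q k (a + 1) v s) • formTwo)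
    (bound := fun s => g₁ s * ‖formOne‖ + g₂ s * ‖formTwo‖) (hb₁.and hb₂)
    (Eventually.of_forall fun v' => (measurable_laplaceIntegrand p q k a v').aestronglyMeasurable)
    (integrableOn_laplaceIntegrand hv hka)
    ((hi₁.aestronglyMeasurable.smul_const _).add
      ((hi₂.aestronglyMeasurable.const_mul Complex.I).smul_const _))
    ((ae_restrict_iff' measurableSet_halfPlane).2 (Eventually.of_forall fun s hs v' hv' => by
      refine (norm_add_le _ _).trans (add_le_add ?_ ?_)
      · rw [norm_smul]
        gcongr
        exact hv'.1 s hs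
      · rw [norm_smul, norm_mul, Complex.norm_I, one_mul]
        gcongr
        exact hv'.2 s hs))
    ((hg₁.mul_const _).add (hg₂.mul_const _))
    (Eventually.of_forall fun s v' _ => hasFDerivAt_laplaceIntegrand p q k a v' s)
  refine hmain.congr_fderiv ?_
  rw [integral_add (hi₁.smul_const _) ((hi₂.const_mul Complex.I).smul_const _),
    integral_smul_const, integral_smul_const, integral_const_mul]
  rfl

theorem contDiffOn_laplaceIntegral (p q : ℝ) (n : ℕ) :
    ∀ k a : ℕ, k + 1 ≤ a → ContDiffOn ℝ n (laplaceIntegral p q k a) (region p q) := by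
  induction n with
  | zero =>
    intro k a hka
    exact contDiffOn_zero.2 fun v hv =>
      (hasFDerivAt_laplaceIntegral hv hka).continuousAt.continuousWithinAt
  | succ n ih =>
    intro k a hka
    rw [Nat.cast_add, Nat.cast_one, contDiffOn_succ_iff_fderiv_of_isOpen (isOpen_region p q)]
    refine ⟨fun v hv =>
      (hasFDerivAt_laplaceIntegral hv hka).differentiableAt.differentiableWithinAt,
      fun h => by simp at h, ?_⟩
    refine ContDiffOn.congr ?_ fun v hv => (hasFDerivAt_laplaceIntegral hv hka).fderiv
    exact ((ih _ _ (by omega)).smul contDiffOn_const).add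
      ((contDiffOn_const.mul (ih _ _ (by omega))).smul contDiffOn_const)

/-! ### Wirtinger derivatives -/

theorem eqOn_wirtinger {U : Set ((ℂ × ℂ) × (ℂ × ℂ))} (hU : IsOpen U)
    {f g : (ℂ × ℂ) × (ℂ × ℂ) → ℂ} (h : EqOn f g U) (e : (ℂ × ℂ) × (ℂ × ℂ)) :
    EqOn (wirtinger e f) (wirtinger e g) U := fun v hv => by
  simp only [wirtinger, (h.eventuallyEq_of_mem (hU.mem_nhds hv)).fderiv_eq]

theorem eqOn_wirtingerBar {U : Set ((ℂ × ℂ) × (ℂ × ℂ))} (hU : IsOpen U)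
    {f g : (ℂ × ℂ) × (ℂ × ℂ) → ℂ} (h : EqOn f g U) (e : (ℂ × ℂ) × (ℂ × ℂ)) :
    EqOn (wirtingerBar e f) (wirtingerBar e g) U := fun v hv => by
  simp only [wirtingerBar, (h.eventuallyEq_of_mem (hU.mem_nhds hv)).fderiv_eq]

theorem fderiv_const_mul_laplaceIntegral {p q : ℝ} {v : (ℂ × ℂ) × (ℂ × ℂ)} (hv : v ∈ region p q)
    {k a : ℕ} (hka : k + 1 ≤ a) (C : ℂ) (e : (ℂ × ℂ) × (ℂ × ℂ)) :
    fderiv ℝ (fun v => C * laplaceIntegral p q k a v) v e =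
      C * (laplaceIntegral p q (k + 1) (a + 1) v * (e.1.1 + star e.2.1) +
        Complex.I * laplaceIntegral p q k (a + 1) v * (e.1.2 - star e.2.2)) := by
  rw [((hasFDerivAt_laplaceIntegral hv hka).const_mul C).fderiv]
  simp [formOne_apply, formTwo_apply]
  ring

theorem iterate_wirtinger_z_one {p q : ℝ} {k a : ℕ} (hka : k + 1 ≤ a) (C : ℂ) (n : ℕ)
    {f : (ℂ × ℂ) × (ℂ × ℂ) → ℂ}
    (hf : EqOn f (fun v => C * laplaceIntegral p q k a v) (region p q)) :
    EqOn ((wirtinger ((1, 0), (0, 0)))^[n] f)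
      (fun v => C * laplaceIntegral p q (k + n) (a + n) v) (region p q) := by
  induction n with
  | zero => exact hf
  | succ n ih =>
    rw [Function.iterate_succ_apply']
    refine (eqOn_wirtinger (isOpen_region p q) ih _).trans fun v hv => ?_
    simp only [wirtinger]
    rw [fderiv_const_mul_laplaceIntegral hv (by omega),
      fderiv_const_mul_laplaceIntegral hv (by omega)]
    simp [← add_assoc]
    linear_combination (-1 / 2 : ℂ) * C * laplaceIntegral p q (k + n + 1) (a + n + 1) v *
      Complex.I_mul_I

theorem iterate_wirtingerBar_w_one {p q : ℝ} {k a : ℕ} (hka : k + 1 ≤ a) (C : ℂ) (n : ℕ)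
    {f : (ℂ × ℂ) × (ℂ × ℂ) → ℂ}
    (hf : EqOn f (fun v => C * laplaceIntegral p q k a v) (region p q)) :
    EqOn ((wirtingerBar ((0, 0), (1, 0)))^[n] f)
      (fun v => C * laplaceIntegral p q (k + n) (a + n) v) (region p q) := by
  induction n with
  | zero => exact hf
  | succ n ih =>
    rw [Function.iterate_succ_apply']
    refine (eqOn_wirtingerBar (isOpen_region p q) ih _).trans fun v hv => ?_
    simp only [wirtingerBar]
    rw [fderiv_const_mul_laplaceIntegral hv (by omega),
      fderiv_const_mul_laplaceIntegral hv (by omega)]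
    simp [← add_assoc]
    linear_combination (-1 / 2 : ℂ) * C * laplaceIntegral p q (k + n + 1) (a + n + 1) v *
      Complex.I_mul_I

theorem iterate_wirtinger_z_two {p q : ℝ} {k a : ℕ} (hka : k + 1 ≤ a) (C : ℂ) (n : ℕ)
    {f : (ℂ × ℂ) × (ℂ × ℂ) → ℂ}
    (hf : EqOn f (fun v => C * laplaceIntegral p q k a v) (region p q)) :
    EqOn ((wirtinger ((0, 1), (0, 0)))^[n] f)
      (fun v => C * Complex.I ^ n * laplaceIntegral p q k (a + n) v) (region p q) := by
  induction n with
  | zero => simpa using hf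
  | succ n ih =>
    rw [Function.iterate_succ_apply']
    refine (eqOn_wirtinger (isOpen_region p q) ih _).trans fun v hv => ?_
    simp only [wirtinger]
    rw [fderiv_const_mul_laplaceIntegral hv (by omega),
      fderiv_const_mul_laplaceIntegral hv (by omega)]
    simp [← add_assoc]
    linear_combination (-1 / 2 : ℂ) * C * Complex.I ^ (n + 1) *
      laplaceIntegral p q k (a + n + 1) v * Complex.I_mul_I

theorem iterate_wirtingerBar_w_two {p q : ℝ} {k a : ℕ} (hka : k + 1 ≤ a) (C : ℂ) (n : ℕ)
    {f : (ℂ × ℂ) × (ℂ × ℂ) → ℂ}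
    (hf : EqOn f (fun v => C * laplaceIntegral p q k a v) (region p q)) :
    EqOn ((wirtingerBar ((0, 0), (0, 1)))^[n] f)
      (fun v => C * (-Complex.I) ^ n * laplaceIntegral p q k (a + n) v) (region p q) := by
  induction n with
  | zero => simpa using hf
  | succ n ih =>
    rw [Function.iterate_succ_apply']
    refine (eqOn_wirtingerBar (isOpen_region p q) ih _).trans fun v hv => ?_
    simp only [wirtingerBar]
    rw [fderiv_const_mul_laplaceIntegral hv (by omega),
      fderiv_const_mul_laplaceIntegral hv (by omega)]
    simp [← add_assoc]
    linear_combination (1 / 2 : ℂ) * C * (-Complex.I) ^ n * Complex.I *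
      laplaceIntegral p q k (a + n + 1) v * Complex.I_mul_I

theorem szegoIntegrand_eq_laplaceIntegrand (p q : ℝ) (v : (ℂ × ℂ) × (ℂ × ℂ)) :
    szegoIntegrand p q v = laplaceIntegrand p q 0 1 v := by
  ext s
  simp only [szegoIntegrand, laplaceIntegrand, pow_zero, one_mul, pow_one, Complex.ofReal_div]
  ring

theorem szegoKernel_eq_laplaceIntegral (p q : ℝ) :
    szegoKernel p q = fun v => szegoConst * laplaceIntegral p q 0 1 v := by
  ext v
  rw [szegoKernel, szegoIntegrand_eq_laplaceIntegrand, laplaceIntegral]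

theorem mixedDeriv_szegoKernel {p q : ℝ} (i₁ j₁ i₂ j₂ : ℕ) {v : (ℂ × ℂ) × (ℂ × ℂ)}
    (hv : v ∈ region p q) :
    mixedDeriv i₁ j₁ i₂ j₂ (szegoKernel p q) v = szegoConst * Complex.I ^ i₂ * (-Complex.I) ^ j₂ *
      laplaceIntegral p q (i₁ + j₁) (i₁ + j₁ + i₂ + j₂ + 1) v := by
  have h0 : EqOn (szegoKernel p q) (fun v => szegoConst * laplaceIntegral p q 0 1 v)
      (region p q) := fun v _ => by rw [szegoKernel_eq_laplaceIntegral]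
  have h1 := iterate_wirtingerBar_w_two (by omega) _ j₂ h0
  have h2 := iterate_wirtinger_z_two (by omega) _ i₂ h1
  have h3 := iterate_wirtingerBar_w_one (by omega) _ j₁ h2
  have h4 := iterate_wirtinger_z_one (by omega) _ i₁ h3
  rw [mixedDeriv, h4 hv]
  simp only
  rw [show 0 + j₁ + i₁ = i₁ + j₁ by omega,
    show 1 + j₂ + i₂ + j₁ + i₁ = i₁ + j₁ + i₂ + j₂ + 1 by omega]
  ring

end TubeSzego

theorem theorem1 (p q : ℝ) (hp : p < 0) :
    -- the integral defining the Szegő kernel converges absolutely in the region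
    (∀ v ∈ TubeSzego.region p q,
      MeasureTheory.IntegrableOn (TubeSzego.szegoIntegrand p q v) TubeSzego.halfPlane) ∧
    -- the region is an open neighbourhood of the closure of `Ω × Ω` without the singular set
    IsOpen (TubeSzego.region p q) ∧
    (closure (TubeSzego.Ω p q) ×ˢ closure (TubeSzego.Ω p q)) \ TubeSzego.singularSet p
      ⊆ TubeSzego.region p q ∧
    -- all derivatives exist in the region and are given by absolutely convergent integrals
    ContDiffOn ℝ ∞ (TubeSzego.szegoKernel p q) (TubeSzego.region p q) ∧
    (∀ i₁ j₁ i₂ j₂ : ℕ, ∀ v ∈ TubeSzego.region p q,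
      MeasureTheory.IntegrableOn (TubeSzego.derivIntegrand p q i₁ j₁ i₂ j₂ v)
        TubeSzego.halfPlane ∧
      TubeSzego.mixedDeriv i₁ j₁ i₂ j₂ (TubeSzego.szegoKernel p q) v =
        TubeSzego.szegoConst * Complex.I ^ i₂ * (-Complex.I) ^ j₂ *
          ∫ s in TubeSzego.halfPlane, TubeSzego.derivIntegrand p q i₁ j₁ i₂ j₂ v s) := by
  refine ⟨fun v hv => ?_, TubeSzego.isOpen_region p q,
    TubeSzego.closure_prod_closure_diff_singularSet_subset_region q hp, ?_,
    fun i₁ j₁ i₂ j₂ v hv => ⟨?_, TubeSzego.mixedDeriv_szegoKernel i₁ j₁ i₂ j₂ hv⟩⟩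
  · rw [TubeSzego.szegoIntegrand_eq_laplaceIntegrand]
    exact TubeSzego.integrableOn_laplaceIntegrand hv le_rfl
  · rw [TubeSzego.szegoKernel_eq_laplaceIntegral, contDiffOn_infty]
    exact fun n => contDiffOn_const.mul (TubeSzego.contDiffOn_laplaceIntegral p q n 0 1 le_rfl)
  · exact TubeSzego.integrableOn_laplaceIntegrand hv (by omega)
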